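/- Let $d,K\ge 1$ be integers, $p\in[1,2]$, $\varepsilon\in(0,1/2)$, $\gamma\in(0,1)$, and let $\mathcal X=\{x\in\mathbb R^d:\|x\|_2\le d^{-(1/p-1/2)}\}$, the Euclidean ball inscribed in the unit $\ell_p$ ball. Let $\mathcal F$ be either the class of convex $f:\mathbb R^d\to\mathbb R$ whose subgradients satisfy $\|g-h\|_{p^*}\le 1$ for all $g\in\partial f(x)$, $h\in\partial f(y)$ and all $x,y\in\mathbb R^d$ (where $1/p+1/p^*=1$), or the class of convex functions on $\mathbb R^d$ that are $1$-Lipschitz with respect to $\|\cdot\|_p$. Let $\mathcal O$ be any local oracle: $\mathcal O_f(x)=\mathcal O_g(x)$ whenever $f,g\in\mathcal F$ agree in a neighbourhood of $x\in\mathcal X$. A deterministic $K$-parallel algorithm $A$ queries in each round $K$ points of $\mathcal X$, chosen as a function of all queries and answers of the previous rounds; $T(A,f,\varepsilon)$ is the number ($\ge 1$) of the first round in which it queries some $x$ with $f(x)-\inf_{\mathcal X}f\le\varepsilon$ ($\infty$ if there is none). Let $$\mathrm{Compl}^{\gamma}_{\mathrm{HP}}(\mathcal F,\mathcal X,K,\varepsilon)=\sup_{\mu}\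 \inf_{A}\ \inf\{\tau\in\mathbb N:\ \mathbb P_{f\sim\mu}[T(A,f,\varepsilon)\le\tau]\ge\gamma\},$$ where $\mu$ ranges over the probability distributions on $\mathcal F$ (with the $\sigma$-algebra generated by the evaluations $f\mapsto f(x)$, non-measurable events being given their outer measure) and $A$ over the deterministic $K$-parallel algorithms. Then: (i) For every real $M$ with $MK>\gamma$ and $$M\le\min\Big\{\frac1{200\,\varepsilon^2},\ \frac{\varepsilon\sqrt d}{32\sqrt{\ln(MK/\gamma)}}\Big\},$$ in particular for the $M$ for which equality holds, $\mathrm{Compl}^{\gamma}_{\mathrm{HP}}(\mathcal F,\mathcal X,K,\varepsilon)\ge M$. (ii) Consequently, for every $p\in[1,2]$, including $p=1$, if $d\ge\frac{16}{625}\,\varepsilon^{-6}\ln\frac{K}{200\,\varepsilon^2\gamma}$, then $\mathrm{Compl}^{\gamma}_{\mathrm{HP}}(\mathcal F,\mathcal X,K,\varepsilon)\ge\frac1{200\,\varepsilon^2}$. -/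

import Mathlib

open scoped ENNReal Topology

noncomputable section

/-- The norm `‖x‖_p` of a vector of `ℝ^d`. -/
def ellNorm {d : ℕ} (p : ℝ) (x : Fin d → ℝ) : ℝ :=
  ‖WithLp.toLp (ENNReal.ofReal p) x‖

/-- The closed Euclidean ball of radius `r` in `ℝ^d`, centred at the origin. -/
def l2Ball (d : ℕ) (r : ℝ) : Set (Fin d → ℝ) :=
  {x | ellNorm 2 x ≤ r}

/-- `g` is a subgradient of `f` at `x`. -/
def IsSubgradient {d : ℕ} (f : (Fin d → ℝ) → ℝ) (x g : Fin d → ℝ) : Prop :=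
  ∀ y, f x + g ⬝ᵥ (y - x) ≤ f y

/-- The nonsmooth class: convex functions on `ℝ^d` such that any two subgradients, taken at any
two points, are at distance at most `μ` in the norm dual to `‖·‖_p`, that is,
`sup {⟨g - h, v⟩ : ‖v‖_p ≤ 1} ≤ μ`. -/
def boundedSubgradientVariation (d : ℕ) (p μ : ℝ) : Set ((Fin d → ℝ) → ℝ) :=
  {f | ConvexOn ℝ Set.univ f ∧
    ∀ x y g h, IsSubgradient f x g → IsSubgradient f y h →
      ∀ v, ellNorm p v ≤ 1 → (g - h) ⬝ᵥ v ≤ μ}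

/-- Convex functions on `ℝ^d` that are `L`-Lipschitz with respect to `‖·‖_p`. -/
def lipschitzConvex (d : ℕ) (p L : ℝ) : Set ((Fin d → ℝ) → ℝ) :=
  {f | ConvexOn ℝ Set.univ f ∧ ∀ x y, |f x - f y| ≤ L * ellNorm p (x - y)}

section Oracle

variable {E : Type*} [TopologicalSpace E] {A : Type*}

/-- An oracle with answers in `A` (`O f x` is the answer to the query `x` when the objective
is `f`) is local for the class `F` on the feasible set `X` if objectives of the class that agree
in a neighbourhood of a feasible point get the same answer at this point. -/
def IsLocalOracle (F : Set (E → ℝ)) (X : Set E) (O : (E → ℝ) → E → A) : Prop :=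
  ∀ f ∈ F, ∀ g ∈ F, ∀ x ∈ X, f =ᶠ[𝓝 x] g → O f x = O g x

end Oracle

section Algorithms

variable {E : Type*} {A : Type*} {X : Set E} {K : ℕ}

/-- A deterministic `K`-parallel algorithm on the feasible set `X`: an arbitrary map that sends
the list of all previous batches of queries, each with its batch of answers, to the next batch
of `K` feasible queries. The first batch is the value at the empty list. -/
def ParallelAlgorithm (X : Set E) (K : ℕ) (A : Type*) :=
  List ((Fin K → X) × (Fin K → A)) → Fin K → X

/-- The queries and answers of the first `t` rounds on the objective `f`. -/
def ParallelAlgorithm.history (alg : ParallelAlgorithm X K A) (O : (E → ℝ) → E → A)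
    (f : E → ℝ) : ℕ → List ((Fin K → X) × (Fin K → A))
  | 0 => []
  | t + 1 =>
    alg.history O f t ++
      [(alg (alg.history O f t), fun k => O f (alg (alg.history O f t) k))]

/-- The batch that is queried right after `t` completed rounds, that is, in round `t + 1`. -/
def ParallelAlgorithm.batch (alg : ParallelAlgorithm X K A) (O : (E → ℝ) → E → A)
    (f : E → ℝ) (t : ℕ) : Fin K → X :=
  alg (alg.history O f t)

/-- A feasible point whose value exceeds the infimum of `f` over `X` by at most `ε`. -/
def IsEpsSolution (f : E → ℝ) (X : Set E) (ε : ℝ) (x : E) : Prop :=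
  x ∈ X ∧ ∀ y ∈ X, f x - f y ≤ ε

/-- The running time: the number (at least `1`) of the first round in which an `ε`-solution is
queried, and `⊤` if this never happens. -/
def ParallelAlgorithm.runningTime (alg : ParallelAlgorithm X K A) (O : (E → ℝ) → E → A)
    (f : E → ℝ) (ε : ℝ) : ℕ∞ :=
  ⨅ (t : ℕ) (_ : ∃ k, IsEpsSolution f X ε (alg.batch O f t k)), ((t + 1 : ℕ) : ℕ∞)

/-- The high-probability complexity
`sup_μ inf_alg inf {τ : ℙ_{f ∼ μ} [T(alg, f, ε) ≤ τ] ≥ γ}`.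
Here `μ` runs over the probability measures on the class `F` with the `σ`-algebra generated by
the evaluations `f ↦ f x`. An event that is not measurable, which can occur since the
algorithm is an arbitrary map, gets its outer measure; this favours the algorithm. -/
def hpComplexity (F : Set (E → ℝ)) (X : Set E) (O : (E → ℝ) → E → A) (K : ℕ) (ε γ : ℝ) : ℝ≥0∞ :=
  ⨆ (μ : MeasureTheory.Measure F) (_ : MeasureTheory.IsProbabilityMeasure μ),
    ⨅ (alg : ParallelAlgorithm X K A) (τ : ℕ)
      (_ : ENNReal.ofReal γ ≤ μ {f | alg.runningTime O (f : E → ℝ) ε ≤ (τ : ℕ∞)}), (τ : ℝ≥0∞)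

end Algorithms

end

/-!
The lower bound is the classical resisting-oracle argument, carried out with random signs.

Take independent uniform sign vectors `r 0, …, r (n - 1)` in `{-1, 1}^d`, where `n` is the largest
integer below `M`, and the objective `max i, (⟨c r i, x⟩ - i δ)` with `c = d^{1/p - 1} / 2` and
`δ = ε / n` (`maxAffine`). By Hölder's inequality it is `1/2`-Lipschitz for `‖·‖_p`, and hence in
both classes. On the ball, of radius `R = d^{-(1/p - 1/2)}`, every `⟨c r i, x⟩` is sub-Gaussian
at the scale `c R = 1 / (2 √d)`.

If a query `x` of the round after `t` completed rounds satisfies `|⟨c r i, x⟩| < δ / 2` for all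
`i ≥ t`, then the pieces after number `t` are strictly below piece `t` at `x`; a local oracle
reveals at most `r 0, …, r t` (`maxAffine_eventuallyEq`). To separate the algorithm from the
randomness, its true history is compared with a truncated one, in which the answers of this round
are computed from the first `t + 1` pieces by definition (`truncatedHistory`). The queries of the
truncated history are independent of the vectors not yet revealed without any conditioning,
so Hoeffding's inequality and a union bound show that all of them are nearly orthogonal to these
vectors, in which case both histories coincide (`history_eq_truncatedHistory`).
All values found are then above `-(n - 1/2) δ ≥ -ε`, because the last vector is never revealed.
On the other hand the sign vectors are nearly orthogonal to each other, so that the point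
`-(R / √(2nd)) ∑ j, r j` is feasible and has a value of at most `-1 / (4 √(2n)) ≤ -2 ε`
(`exists_descent_point`); no query is an `ε`-solution.

The union bound (`union_bound_lt`) needs `M K ≥ 2 γ`. Otherwise `M ≤ 1`, where nothing is to be
shown, or `K = 1`, `M < 2` and `γ > 1/2`, where one query has to fail with probability at least
`1/2`: two opposite linear objectives do (`le_hpComplexity_of_half_lt`).

All distributions are uniform on finite families. As the objectives are continuous, singletons are
measurable, and probabilities, including outer measures, reduce to counting
(`le_hpComplexity_of_card_lt`).
-/


/-! ### The `ℓ_p` norm -/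

lemma ellNorm_eq_sum {d : ℕ} {p : ℝ} (hp : 0 < p) (x : Fin d → ℝ) :
    ellNorm p x = (∑ i, |x i| ^ p) ^ (1 / p) := by
  have h : (ENNReal.ofReal p).toReal = p := ENNReal.toReal_ofReal hp.le
  unfold ellNorm
  rw [PiLp.norm_eq_sum (by rw [h]; exact hp), h]
  rfl

lemma ellNorm_two_le_iff {d : ℕ} {r : ℝ} (hr : 0 ≤ r) (x : Fin d → ℝ) :
    ellNorm 2 x ≤ r ↔ ∑ i, x i ^ 2 ≤ r ^ 2 := by
  rw [ellNorm_eq_sum two_pos, ← Real.sqrt_eq_rpow, Real.sqrt_le_left hr]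
  simp

lemma sum_abs_le_rpow_mul_ellNorm {d : ℕ} {p : ℝ} (hp : 1 ≤ p) (x : Fin d → ℝ) :
    ∑ i, |x i| ≤ (d : ℝ) ^ (1 - 1 / p) * ellNorm p x := by
  have hp0 : 0 < p := by linarith
  have h := Real.rpow_sum_le_const_mul_sum_rpow (s := Finset.univ) (f := x) hp
  have h' := Real.rpow_le_rpow (by positivity) h (by positivity : 0 ≤ 1 / p)
  rw [← Real.rpow_mul (by positivity), mul_one_div_cancel hp0.ne', Real.rpow_one,
    Real.mul_rpow (by positivity) (by positivity), ← Real.rpow_mul (by positivity)] at h'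
  rw [ellNorm_eq_sum hp0]
  convert h' using 3
  · simp
  · field_simp

lemma abs_dotProduct_le_mul_ellNorm {d : ℕ} (hd : 1 ≤ d) {p c : ℝ} (hp : 1 ≤ p) (hc : 0 ≤ c)
    {w : Fin d → ℝ} (hw : ∀ i, |w i| ≤ c * (d : ℝ) ^ (1 / p - 1)) (v : Fin d → ℝ) :
    |w ⬝ᵥ v| ≤ c * ellNorm p v := by
  have hd0 : (0 : ℝ) < d := by exact_mod_cast hd
  calc |w ⬝ᵥ v| ≤ ∑ i, |w i * v i| := Finset.abs_sum_le_sum_abs _ _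
    _ ≤ ∑ i, c * (d : ℝ) ^ (1 / p - 1) * |v i| := by
        gcongr with i
        rw [abs_mul]
        gcongr
        exact hw i
    _ = c * (d : ℝ) ^ (1 / p - 1) * ∑ i, |v i| := by rw [Finset.mul_sum]
    _ ≤ c * (d : ℝ) ^ (1 / p - 1) * ((d : ℝ) ^ (1 - 1 / p) * ellNorm p v) := by
        gcongr
        exact sum_abs_le_rpow_mul_ellNorm hp v
    _ = c * ellNorm p v := by
        rw [← mul_assoc, mul_assoc c, ← Real.rpow_add hd0]
        simp

/-! ### The two classes of objectives -/

/-- A convex function that is `1/2`-Lipschitz with respect to `‖·‖_p` belongs to both classes: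
its subgradients have dual norm at most `1/2`, so that any two of them are at distance at most
`1`. -/
lemma mem_class_of_convexOn_of_lipschitz {d : ℕ} {p : ℝ} {F : Set ((Fin d → ℝ) → ℝ)}
    (hF : F = boundedSubgradientVariation d p 1 ∨ F = lipschitzConvex d p 1)
    {f : (Fin d → ℝ) → ℝ} (hf : ConvexOn ℝ Set.univ f)
    (hL : ∀ x y, |f x - f y| ≤ 1 / 2 * ellNorm p (x - y)) : f ∈ F := by
  rcases hF with rfl | rfl
  · refine ⟨hf, fun x y g h hg hh v hv => ?_⟩
    have h1 := hg (x + v)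
    have h2 := hh (y - v)
    have h3 := (abs_le.1 (hL (x + v) x)).2
    have h4 := (abs_le.1 (hL y (y - v))).1
    simp only [add_sub_cancel_left, sub_sub_cancel, sub_sub_cancel_left, dotProduct_neg]
      at h1 h2 h3 h4
    rw [sub_dotProduct]
    linarith
  · refine ⟨hf, fun x y => (hL x y).trans ?_⟩
    have : 0 ≤ ellNorm p (x - y) := by
      have := (abs_nonneg _).trans (hL x y)
      linarith
    linarith

lemma continuous_of_mem_class {d : ℕ} {p : ℝ} {F : Set ((Fin d → ℝ) → ℝ)}
    (hF : F = boundedSubgradientVariation d p 1 ∨ F = lipschitzConvex d p 1)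
    {f : (Fin d → ℝ) → ℝ} (hf : f ∈ F) : Continuous f := by
  have h : ConvexOn ℝ Set.univ f := by
    rcases hF with rfl | rfl <;> exact hf.1
  exact continuousOn_univ.1 (h.continuousOn isOpen_univ)

/-! ### Uniform distributions on finitely many objectives -/

section Uniform

open MeasureTheory

variable {E : Type*} [TopologicalSpace E] [TopologicalSpace.SeparableSpace E] {A : Type*}

/-- On a class of continuous functions the evaluations at a countable dense set separate points,
so that singletons are measurable although the whole product `σ`-algebra does not have them. -/
lemma measurableSingletonClass_of_continuous {F : Set (E → ℝ)} (hF : ∀ f ∈ F, Continuous f) :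
    MeasurableSingletonClass F := by
  refine ⟨fun f => ?_⟩
  obtain ⟨s, hs, hd⟩ := TopologicalSpace.exists_countable_dense E
  have h : ({f} : Set F) = ⋂ x ∈ s, {g : F | g.1 x = f.1 x} := by
    ext g
    simp only [Set.mem_singleton_iff, Set.mem_iInter, Set.mem_ofPred_eq]
    refine ⟨fun h x _ => by rw [h], fun h => Subtype.ext ?_⟩
    exact Continuous.ext_on hd (hF _ g.2) (hF _ f.2) h
  rw [h]
  refine MeasurableSet.biInter hs fun x _ => ?_
  exact measurableSet_eq_fun ((measurable_pi_apply x).comp measurable_subtype_coe)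
    measurable_const

lemma runningTime_le_iff {E A : Type*} {X : Set E} {K : ℕ} (alg : ParallelAlgorithm X K A)
    (O : (E → ℝ) → E → A) (f : E → ℝ) (ε : ℝ) (τ : ℕ) :
    alg.runningTime O f ε ≤ τ ↔ ∃ t < τ, ∃ k, IsEpsSolution f X ε (alg.batch O f t k) := by
  unfold ParallelAlgorithm.runningTime
  constructor
  · intro h
    by_contra! hc
    have : ((τ + 1 : ℕ) : ℕ∞) ≤ τ := by
      refine le_trans (le_iInf₂ fun t ht => ?_) h
      have : τ ≤ t := by
        by_contra! hlt
        obtain ⟨k, hk⟩ := ht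
        exact hc t hlt k hk
      exact_mod_cast Nat.succ_le_succ this
    have : τ + 1 ≤ τ := by exact_mod_cast this
    omega
  · rintro ⟨t, ht, hk⟩
    refine (iInf₂_le t hk).trans ?_
    exact_mod_cast ht

open Classical in
/-- To bound the high-probability complexity from below it is enough to count, in a finite
family of objectives, those that a given algorithm solves within a given number of rounds. -/
lemma le_hpComplexity_of_card_lt {ι : Type*} [Fintype ι] [Nonempty ι] {F : Set (E → ℝ)}
    (hF : ∀ f ∈ F, Continuous f) {X : Set E} {O : (E → ℝ) → E → A} {K : ℕ} {ε γ M : ℝ}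
    (f : ι → E → ℝ) (hf : ∀ i, f i ∈ F)
    (h : ∀ (alg : ParallelAlgorithm X K A) (τ : ℕ), (τ : ℝ) < M →
      ((Finset.univ.filter fun i => ∃ t < τ, ∃ k,
        IsEpsSolution (f i) X ε (alg.batch O (f i) t k)).card : ℝ) < γ * Fintype.card ι) :
    ENNReal.ofReal M ≤ hpComplexity F X O K ε γ := by
  have := measurableSingletonClass_of_continuous hF
  set μ : Measure F := (Fintype.card ι : ℝ≥0∞)⁻¹ • ∑ i, Measure.dirac ⟨f i, hf i⟩ with hμ
  have hc0 : (Fintype.card ι : ℝ≥0∞) ≠ 0 := by simp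
  have hcT : (Fintype.card ι : ℝ≥0∞) ≠ ⊤ := by simp
  have happ : ∀ S : Set F, μ S = (Fintype.card ι : ℝ≥0∞)⁻¹ *
      ((Finset.univ.filter fun i => (⟨f i, hf i⟩ : F) ∈ S).card : ℝ≥0∞) := by
    intro S
    rw [hμ, Measure.smul_apply, Measure.finsetSum_apply, smul_eq_mul]
    simp [Set.indicator_apply]
  have hprob : IsProbabilityMeasure μ := by
    refine ⟨?_⟩
    rw [happ]
    simp [ENNReal.inv_mul_cancel hc0 hcT]
  refine le_iSup₂_of_le μ hprob (le_iInf fun alg => le_iInf₂ fun τ hτ => ?_)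
  by_contra! hlt
  have hτM : (τ : ℝ) < M := by
    rw [← ENNReal.ofReal_natCast, ENNReal.ofReal_lt_ofReal_iff'] at hlt
    exact hlt.1
  have hcard := h alg τ hτM
  rw [happ] at hτ
  simp only [Set.mem_ofPred_eq, runningTime_le_iff] at hτ
  rw [← ENNReal.div_eq_inv_mul, ENNReal.le_div_iff_mul_le (Or.inl hc0) (Or.inl hcT)] at hτ
  have hγ : 0 < γ := by
    by_contra! hγ
    have : γ * Fintype.card ι ≤ 0 := mul_nonpos_of_nonpos_of_nonneg hγ (by positivity)
    have : (0 : ℝ) ≤ ((Finset.univ.filter fun i => ∃ t < τ, ∃ k,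
        IsEpsSolution (f i) X ε (alg.batch O (f i) t k)).card : ℝ) := by positivity
    linarith
  rw [← ENNReal.ofReal_natCast, ← ENNReal.ofReal_natCast, ← ENNReal.ofReal_mul hγ.le,
    ENNReal.ofReal_le_ofReal_iff (by positivity)] at hτ
  linarith

end Uniform

/-! ### Random signs -/

/-- The sign vector in `{-1, 1}^d` that is encoded by a vector of Booleans. -/
def signVec {d : ℕ} (b : Fin d → Bool) : Fin d → ℝ :=
  fun l => if b l then 1 else -1

lemma signVec_mul_self {d : ℕ} (b : Fin d → Bool) (l : Fin d) :
    signVec b l * signVec b l = 1 := by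
  unfold signVec
  split_ifs <;> norm_num

lemma abs_signVec {d : ℕ} (b : Fin d → Bool) (l : Fin d) : |signVec b l| = 1 := by
  unfold signVec
  split_ifs <;> norm_num

lemma signVec_dotProduct_self {d : ℕ} (b : Fin d → Bool) :
    signVec b ⬝ᵥ signVec b = d := by
  simp [dotProduct, signVec_mul_self]

lemma sum_exp_signVec_dotProduct_le {d : ℕ} (y : Fin d → ℝ) :
    ∑ b : Fin d → Bool, Real.exp (signVec b ⬝ᵥ y) ≤
      Fintype.card (Fin d → Bool) * Real.exp ((∑ l, y l ^ 2) / 2) := by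
  have h : ∑ b : Fin d → Bool, Real.exp (signVec b ⬝ᵥ y) =
      ∏ l, ∑ s : Bool, Real.exp ((if s then 1 else -1) * y l) := by
    rw [Finset.prod_univ_sum]
    simp only [Fintype.piFinset_univ, ← Real.exp_sum]
    rfl
  rw [h]
  calc ∏ l, ∑ s : Bool, Real.exp ((if s then 1 else -1) * y l)
      = ∏ l, 2 * Real.cosh (y l) := by
        refine Finset.prod_congr rfl fun l _ => ?_
        rw [Real.cosh_eq]
        simp only [Fintype.sum_bool, if_true, Bool.false_eq_true, if_false]
        ring_nf
    _ ≤ ∏ l, 2 * Real.exp (y l ^ 2 / 2) := by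
        gcongr with l
        exact Real.cosh_le_exp_half_sq _
    _ = _ := by
        rw [Finset.prod_mul_distrib, ← Real.exp_sum, Finset.sum_div]
        simp

/-- Averaging over a product after resampling one coordinate changes nothing. -/
lemma card_mul_sum_eq_sum_update {ι S : Type*} [Fintype ι] [DecidableEq ι] [Fintype S] (i : ι)
    (g : (ι → S) → ℝ) :
    Fintype.card S * ∑ r, g r = ∑ r : ι → S, ∑ v : S, g (Function.update r i v) := by
  -- the involution that exchanges the coordinate `i` with the fresh sample
  let e : (ι → S) × S → (ι → S) × S := fun q => (Function.update q.1 i q.2, q.1 i)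
  have he : Function.Involutive e := fun q => by simp [e]
  rw [← Fintype.sum_prod_type' (fun r v => g (Function.update r i v))]
  rw [show ∑ q : (ι → S) × S, g (Function.update q.1 i q.2) = ∑ q : (ι → S) × S, g (e q).1
    from rfl, show ∑ q : (ι → S) × S, g (e q).1 = ∑ q : (ι → S) × S, g q.1
    from Equiv.sum_comp (he.toPerm e) fun q => g q.1, Fintype.sum_prod_type]
  simp [Finset.mul_sum]

/-- One-sided Hoeffding bound: `Y` may depend on the random signs, but not on the vector number
`i`. -/
lemma card_le_signVec_dotProduct {ι : Type*} [Fintype ι] [DecidableEq ι] {d : ℕ} (i : ι)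
    (Y : (ι → Fin d → Bool) → Fin d → ℝ) (hY : ∀ r v, Y (Function.update r i v) = Y r)
    {ρ s : ℝ} (hρ : 0 < ρ) (hs : 0 ≤ s) (hYρ : ∀ r, ∑ l, Y r l ^ 2 ≤ ρ) :
    ((Finset.univ.filter fun r => s ≤ signVec (r i) ⬝ᵥ Y r).card : ℝ) ≤
      Fintype.card (ι → Fin d → Bool) * Real.exp (-(s ^ 2 / (2 * ρ))) := by
  set lam := s / ρ with hlam
  have hlam0 : 0 ≤ lam := by positivity
  have hN : (0 : ℝ) < Fintype.card (Fin d → Bool) := by exact_mod_cast Fintype.card_pos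
  -- moment generating function at the optimal parameter `s / ρ`
  have h1 : ∑ r : ι → Fin d → Bool, Real.exp (lam * (signVec (r i) ⬝ᵥ Y r)) ≤
      Fintype.card (ι → Fin d → Bool) * Real.exp (lam ^ 2 * ρ / 2) := by
    refine le_of_mul_le_mul_left ?_ hN
    rw [card_mul_sum_eq_sum_update i]
    calc _ ≤ ∑ r : ι → Fin d → Bool,
          (Fintype.card (Fin d → Bool) : ℝ) * Real.exp (lam ^ 2 * ρ / 2) := by
          refine Finset.sum_le_sum fun r _ => ?_
          have := sum_exp_signVec_dotProduct_le (lam • Y r)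
          simp only [hY, Function.update_self, dotProduct_smul, smul_eq_mul] at this ⊢
          refine this.trans ?_
          gcongr
          simp only [Pi.smul_apply, smul_eq_mul, mul_pow, ← Finset.mul_sum]
          gcongr
          exact hYρ r
      _ = _ := by
          rw [Finset.sum_const, Finset.card_univ, nsmul_eq_mul]
          ring
  have h2 : ((Finset.univ.filter fun r => s ≤ signVec (r i) ⬝ᵥ Y r).card : ℝ) *
      Real.exp (lam * s) ≤ ∑ r : ι → Fin d → Bool, Real.exp (lam * (signVec (r i) ⬝ᵥ Y r)) := by
    rw [← nsmul_eq_mul, ← Finset.sum_const]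
    refine (Finset.sum_le_sum fun r hr => ?_).trans
      (Finset.sum_le_sum_of_subset_of_nonneg (Finset.filter_subset _ _)
        fun _ _ _ => (Real.exp_pos _).le)
    have := (Finset.mem_filter.1 hr).2
    gcongr
  have h3 := h2.trans h1
  rw [← le_div_iff₀ (Real.exp_pos _), mul_div_assoc, ← Real.exp_sub] at h3
  refine h3.trans_eq ?_
  congr 2
  rw [hlam]
  field_simp
  ring

lemma card_le_abs_signVec_dotProduct {ι : Type*} [Fintype ι] [DecidableEq ι] {d : ℕ} (i : ι)
    (Y : (ι → Fin d → Bool) → Fin d → ℝ) (hY : ∀ r v, Y (Function.update r i v) = Y r)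
    {ρ s : ℝ} (hρ : 0 < ρ) (hs : 0 ≤ s) (hYρ : ∀ r, ∑ l, Y r l ^ 2 ≤ ρ) :
    ((Finset.univ.filter fun r => s ≤ |signVec (r i) ⬝ᵥ Y r|).card : ℝ) ≤
      2 * Fintype.card (ι → Fin d → Bool) * Real.exp (-(s ^ 2 / (2 * ρ))) := by
  have h1 := card_le_signVec_dotProduct i Y hY hρ hs hYρ
  have h2 := card_le_signVec_dotProduct i (fun r => -Y r) (fun r v => by rw [hY]) hρ hs
    (fun r => by simpa using hYρ r)
  have h3 : (Finset.univ.filter fun r => s ≤ |signVec (r i) ⬝ᵥ Y r|).card ≤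
      (Finset.univ.filter fun r => s ≤ signVec (r i) ⬝ᵥ Y r).card +
      (Finset.univ.filter fun r => s ≤ signVec (r i) ⬝ᵥ (-Y r)).card := by
    refine (Finset.card_le_card fun r hr => ?_).trans (Finset.card_union_le _ _)
    simpa [le_abs] using hr
  have h4 : ((Finset.univ.filter fun r => s ≤ |signVec (r i) ⬝ᵥ Y r|).card : ℝ) ≤
      ((Finset.univ.filter fun r => s ≤ signVec (r i) ⬝ᵥ Y r).card : ℝ) +
      ((Finset.univ.filter fun r => s ≤ signVec (r i) ⬝ᵥ (-Y r)).card : ℝ) := by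
    exact_mod_cast h3
  linarith

/-! ### Maxima of affine functions and the truncated process -/

/-- The maximum of the affine functions `⟨w i, ·⟩ - i δ` over `i ≤ j`. -/
def maxAffine {d : ℕ} (w : ℕ → Fin d → ℝ) (δ : ℝ) (j : ℕ) (x : Fin d → ℝ) : ℝ :=
  (Finset.range (j + 1)).sup' Finset.nonempty_range_add_one fun i => w i ⬝ᵥ x - i * δ

section MaxAffine

variable {d : ℕ} {w : ℕ → Fin d → ℝ} {δ : ℝ} {j : ℕ}

lemma maxAffine_le_iff {x : Fin d → ℝ} {c : ℝ} :
    maxAffine w δ j x ≤ c ↔ ∀ i ≤ j, w i ⬝ᵥ x - i * δ ≤ c := by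
  simp [maxAffine, Finset.sup'_le_iff]

lemma le_maxAffine {i : ℕ} (hi : i ≤ j) (x : Fin d → ℝ) :
    w i ⬝ᵥ x - i * δ ≤ maxAffine w δ j x :=
  maxAffine_le_iff.1 le_rfl i hi

lemma convexOn_maxAffine : ConvexOn ℝ Set.univ (maxAffine w δ j) := by
  refine ⟨convex_univ, fun x _ y _ a b ha hb hab => maxAffine_le_iff.2 fun i hi => ?_⟩
  have hx := mul_le_mul_of_nonneg_left (le_maxAffine (w := w) (δ := δ) hi x) ha
  have hy := mul_le_mul_of_nonneg_left (le_maxAffine (w := w) (δ := δ) hi y) hb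
  simp only [dotProduct_add, dotProduct_smul, smul_eq_mul]
  have : (i : ℝ) * δ = a * (i * δ) + b * (i * δ) := by rw [← add_mul, hab, one_mul]
  linarith

lemma abs_maxAffine_sub_le {p : ℝ}
    (hw : ∀ i v, |w i ⬝ᵥ v| ≤ 1 / 2 * ellNorm p v) (x y : Fin d → ℝ) :
    |maxAffine w δ j x - maxAffine w δ j y| ≤ 1 / 2 * ellNorm p (x - y) := by
  have key : ∀ i, |w i ⬝ᵥ x - w i ⬝ᵥ y| ≤ 1 / 2 * ellNorm p (x - y) := fun i => by
    rw [← dotProduct_sub]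
    exact hw i _
  rw [abs_sub_le_iff]
  constructor <;> rw [sub_le_iff_le_add, maxAffine_le_iff] <;> intro i hi
  · have := le_maxAffine (w := w) (δ := δ) hi y
    have := (abs_sub_le_iff.1 (key i)).1
    linarith
  · have := le_maxAffine (w := w) (δ := δ) hi x
    have := (abs_sub_le_iff.1 (key i)).2
    linarith

/-- Near a point at which the affine function number `t` exceeds all later ones, the latter do
not contribute to the maximum, so that a local oracle does not reveal them. -/
lemma maxAffine_eventuallyEq {t : ℕ} (htj : t ≤ j) {x : Fin d → ℝ}
    (h : ∀ i, t < i → i ≤ j → w i ⬝ᵥ x - i * δ < w t ⬝ᵥ x - t * δ) :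
    maxAffine w δ j =ᶠ[𝓝 x] maxAffine w δ t := by
  have hcont : ∀ i : ℕ, Continuous fun y : Fin d → ℝ => w i ⬝ᵥ y - i * δ := fun i => by
    simp only [dotProduct]
    fun_prop
  have hev : ∀ᶠ y in 𝓝 x, ∀ i ∈ Finset.Ioc t j, w i ⬝ᵥ y - i * δ < w t ⬝ᵥ y - t * δ := by
    rw [Finset.eventually_all]
    intro i hi
    rw [Finset.mem_Ioc] at hi
    exact (hcont i).continuousAt.eventually_lt (hcont t).continuousAt (h i hi.1 hi.2)
  filter_upwards [hev] with y hy
  refine le_antisymm (maxAffine_le_iff.2 fun i hi => ?_)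
    (maxAffine_le_iff.2 fun i hi => le_maxAffine (hi.trans htj) y)
  by_cases hit : i ≤ t
  · exact le_maxAffine hit y
  · exact (hy i (Finset.mem_Ioc.2 ⟨by omega, hi⟩)).le.trans (le_maxAffine le_rfl y)

lemma maxAffine_congr {w' : ℕ → Fin d → ℝ} (h : ∀ i ≤ j, w i = w' i) :
    maxAffine w δ j = maxAffine w' δ j := by
  ext x
  refine le_antisymm (maxAffine_le_iff.2 fun i hi => ?_) (maxAffine_le_iff.2 fun i hi => ?_)
  · rw [h i hi]
    exact le_maxAffine hi x
  · rw [← h i hi]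
    exact le_maxAffine hi x

end MaxAffine

section Truncated

variable {d : ℕ} {A : Type*} {X : Set (Fin d → ℝ)} {K : ℕ}

/-- The history of an algorithm all of whose queries in the round after `t` completed rounds are
answered according to the maximum of the first `t + 1` affine functions only. Unlike the true
history, it depends on `w 0, …, w (t - 1)` only, whatever the algorithm does. -/
def truncatedHistory (alg : ParallelAlgorithm X K A)
    (O : ((Fin d → ℝ) → ℝ) → (Fin d → ℝ) → A) (w : ℕ → Fin d → ℝ) (δ : ℝ) :
    ℕ → List ((Fin K → X) × (Fin K → A))
  | 0 => []
  | t + 1 =>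
    truncatedHistory alg O w δ t ++
      [(alg (truncatedHistory alg O w δ t),
        fun k => O (maxAffine w δ t) (alg (truncatedHistory alg O w δ t) k))]

lemma truncatedHistory_congr (alg : ParallelAlgorithm X K A)
    (O : ((Fin d → ℝ) → ℝ) → (Fin d → ℝ) → A) {w w' : ℕ → Fin d → ℝ} (δ : ℝ) {t : ℕ}
    (h : ∀ i < t, w i = w' i) :
    truncatedHistory alg O w δ t = truncatedHistory alg O w' δ t := by
  induction t with
  | zero => rfl
  | succ t ih =>
    simp only [truncatedHistory]
    rw [ih fun i hi => h i (by omega), maxAffine_congr fun i hi => h i (by omega)]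

variable {F : Set ((Fin d → ℝ) → ℝ)} {O : ((Fin d → ℝ) → ℝ) → (Fin d → ℝ) → A}
  {w : ℕ → Fin d → ℝ} {δ : ℝ} {N : ℕ}

/-- As long as all queries are nearly orthogonal to the vectors not yet revealed, the true
history is the truncated one. -/
lemma history_eq_truncatedHistory (hO : IsLocalOracle F X O) (hF : ∀ j, maxAffine w δ j ∈ F)
    (alg : ParallelAlgorithm X K A)
    (hw : ∀ t ≤ N, ∀ i ≤ N, t ≤ i → ∀ k,
      |w i ⬝ᵥ (alg (truncatedHistory alg O w δ t) k : Fin d → ℝ)| < δ / 2) {t : ℕ}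
    (ht : t ≤ N) :
    alg.history O (maxAffine w δ N) t = truncatedHistory alg O w δ t := by
  induction t with
  | zero => rfl
  | succ t ih =>
    simp only [ParallelAlgorithm.history, truncatedHistory]
    rw [ih (by omega)]
    congr 3
    ext k
    refine hO _ (hF _) _ (hF _) _ (Subtype.coe_prop _)
      (maxAffine_eventuallyEq (by omega) fun i hti hiN => ?_)
    have h1 := (abs_lt.1 (hw t (by omega) t (by omega) le_rfl k)).1
    have h2 := (abs_lt.1 (hw t (by omega) i hiN hti.le k)).2
    have hδ : 0 < δ := by
      have := (abs_nonneg _).trans_lt (hw t (by omega) t (by omega) le_rfl k)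
      linarith
    have h3 : ((t : ℝ) + 1) * δ ≤ i * δ := by
      gcongr
      exact_mod_cast hti
    linarith

/-- If moreover some feasible point has a value below `-(N + 1/2) δ - ε`, then none of the first
`N + 1` batches contains an `ε`-solution. -/
lemma not_isEpsSolution_batch (hO : IsLocalOracle F X O) (hF : ∀ j, maxAffine w δ j ∈ F)
    (alg : ParallelAlgorithm X K A)
    (hw : ∀ t ≤ N, ∀ i ≤ N, t ≤ i → ∀ k,
      |w i ⬝ᵥ (alg (truncatedHistory alg O w δ t) k : Fin d → ℝ)| < δ / 2)
    {ε : ℝ} {y : Fin d → ℝ} (hy : y ∈ X)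
    (hval : maxAffine w δ N y ≤ -((N + 1 / 2) * δ) - ε) {t : ℕ} (ht : t ≤ N) (k : Fin K) :
    ¬ IsEpsSolution (maxAffine w δ N) X ε (alg.batch O (maxAffine w δ N) t k) := by
  rintro ⟨-, h⟩
  have h1 := h y hy
  rw [ParallelAlgorithm.batch, history_eq_truncatedHistory hO hF alg hw ht] at h1
  have h2 := le_maxAffine (w := w) (δ := δ) le_rfl
    (alg (truncatedHistory alg O w δ t) k : Fin d → ℝ) (j := N)
  have h3 := (abs_lt.1 (hw t ht N le_rfl ht k)).1
  linarith

end Truncated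

/-! ### The random hard instances -/

/-- Nearly orthogonal sign vectors have a common direction of descent: along `-∑ j, r j` all the
affine functions decrease at the rate they would have for exactly orthogonal vectors, up to a
constant factor. -/
lemma exists_descent_point {n d : ℕ} (hn : 1 ≤ n) (hd : 1 ≤ d) {R : ℝ} (hR : 0 ≤ R)
    (r : Fin n → Fin d → Bool)
    (hr : ∀ i j, i ≠ j → |signVec (r i) ⬝ᵥ signVec (r j)| < d / (2 * n)) :
    ∃ y ∈ l2Ball d R, ∀ i, signVec (r i) ⬝ᵥ y ≤ -(R * √d / (2 * √(2 * n))) := by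
  have hn0 : (0 : ℝ) < n := by exact_mod_cast hn
  have hd0 : (0 : ℝ) < d := by exact_mod_cast hd
  set v : Fin d → ℝ := ∑ j, signVec (r j) with hv
  have hiv : ∀ i, |signVec (r i) ⬝ᵥ v - d| ≤ d / 2 := fun i => by
    rw [hv, dotProduct_sum, ← Finset.add_sum_erase _ _ (Finset.mem_univ i),
      signVec_dotProduct_self, add_sub_cancel_left]
    calc _ ≤ ∑ j ∈ Finset.univ.erase i, |signVec (r i) ⬝ᵥ signVec (r j)| :=
          Finset.abs_sum_le_sum_abs _ _
      _ ≤ ∑ j ∈ Finset.univ.erase i, (d : ℝ) / (2 * n) :=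
          Finset.sum_le_sum fun j hj => (hr i j (Finset.ne_of_mem_erase hj).symm).le
      _ ≤ ∑ j : Fin n, (d : ℝ) / (2 * n) :=
          Finset.sum_le_sum_of_subset_of_nonneg (Finset.erase_subset _ _)
            fun _ _ _ => by positivity
      _ = d / 2 := by
          rw [Finset.sum_const, Finset.card_univ, Fintype.card_fin, nsmul_eq_mul]
          field_simp
  have hvv : v ⬝ᵥ v ≤ 2 * n * d := by
    conv_lhs => rw [hv, sum_dotProduct]
    rw [← hv]
    calc _ ≤ ∑ i : Fin n, (2 * d : ℝ) :=
          Finset.sum_le_sum fun i _ => by linarith [(abs_le.1 (hiv i)).2]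
      _ = 2 * n * d := by
          rw [Finset.sum_const, Finset.card_univ, Fintype.card_fin, nsmul_eq_mul]
          ring
  refine ⟨-(R / √(2 * n * d)) • v, (ellNorm_two_le_iff hR _).2 ?_, fun i => ?_⟩
  · have h1 : ∑ l, v l ^ 2 = v ⬝ᵥ v := by simp [dotProduct, sq]
    simp only [Pi.smul_apply, smul_eq_mul, mul_pow, ← Finset.mul_sum, neg_sq, div_pow, h1]
    rw [Real.sq_sqrt (by positivity), div_mul_eq_mul_div, div_le_iff₀ (by positivity)]
    gcongr
  · have h1 := (abs_le.1 (hiv i)).1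
    rw [dotProduct_smul, smul_eq_mul, neg_mul, neg_le_neg_iff]
    calc R * √d / (2 * √(2 * n)) = R / √(2 * n * d) * (d / 2) := by
          rw [Real.sqrt_mul (by positivity : (0 : ℝ) ≤ 2 * n) d]
          nth_rewrite 3 [← Real.mul_self_sqrt hd0.le]
          field_simp
      _ ≤ R / √(2 * n * d) * (signVec (r i) ⬝ᵥ v) := by
          gcongr
          linarith

/-- The vectors `c • r 0, …, c • r (n - 1)`, continued by zero. -/
def scaledSigns {n d : ℕ} (c : ℝ) (r : Fin n → Fin d → Bool) (i : ℕ) : Fin d → ℝ :=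
  if h : i < n then c • signVec (r ⟨i, h⟩) else 0

lemma abs_scaledSigns_le {n d : ℕ} {c : ℝ} (hc : 0 ≤ c) (r : Fin n → Fin d → Bool) (i : ℕ)
    (l : Fin d) : |scaledSigns c r i l| ≤ c := by
  unfold scaledSigns
  split_ifs
  · simp [abs_mul, abs_signVec, abs_of_nonneg hc]
  · simpa using hc

lemma scaledSigns_update {n d : ℕ} (c : ℝ) (r : Fin n → Fin d → Bool) (i : Fin n)
    (v : Fin d → Bool) {j : ℕ} (hj : j < i) :
    scaledSigns c (Function.update r i v) j = scaledSigns c r j := by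
  unfold scaledSigns
  split_ifs
  · rw [Function.update_of_ne]
    rintro rfl
    exact lt_irrefl _ hj
  · rfl

open Classical in
/-- Union bound: for a fixed algorithm, few of the random instances are solved within `n` rounds,
since a solution requires a query that is correlated with a vector not yet revealed, or two
correlated sign vectors. -/
lemma card_solved_le {n d K : ℕ} (hn : 1 ≤ n) (hd : 1 ≤ d) {A : Type*} {c R δ ε : ℝ}
    (hc : 0 < c) (hR : 0 < R) (hcR : c * R * √d = 1 / 2) (hδ : 0 < δ)
    (hval : n * δ + ε ≤ 1 / (4 * √(2 * n)))
    {F : Set ((Fin d → ℝ) → ℝ)} {O : ((Fin d → ℝ) → ℝ) → (Fin d → ℝ) → A}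
    (hO : IsLocalOracle F (l2Ball d R) O)
    (hF : ∀ (r : Fin n → Fin d → Bool) j, maxAffine (scaledSigns c r) δ j ∈ F)
    (alg : ParallelAlgorithm (l2Ball d R) K A) {τ : ℕ} (hτ : τ ≤ n) :
    ((Finset.univ.filter fun r : Fin n → Fin d → Bool => ∃ t < τ, ∃ k,
      IsEpsSolution (maxAffine (scaledSigns c r) δ (n - 1)) (l2Ball d R) ε
        (alg.batch O (maxAffine (scaledSigns c r) δ (n - 1)) t k)).card : ℝ) ≤
      2 * n ^ 2 * (K * Real.exp (-(δ ^ 2 * d / 2)) + Real.exp (-(d / (8 * n ^ 2)))) *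
        Fintype.card (Fin n → Fin d → Bool) := by
  have hn0 : (0 : ℝ) < n := by exact_mod_cast hn
  have hd0 : (0 : ℝ) < d := by exact_mod_cast hd
  let Y : ℕ → Fin K → (Fin n → Fin d → Bool) → Fin d → ℝ := fun t k r =>
    alg (truncatedHistory alg O (scaledSigns c r) δ t) k
  let B₁ : Fin n × Fin K × Fin n → Finset (Fin n → Fin d → Bool) := fun q =>
    if q.1 ≤ q.2.2 then
      Finset.univ.filter fun r => δ / (2 * c) ≤ |signVec (r q.2.2) ⬝ᵥ Y q.1 q.2.1 r|
    else ∅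
  let B₂ : Fin n × Fin n → Finset (Fin n → Fin d → Bool) := fun q =>
    if q.1 ≠ q.2 then
      Finset.univ.filter fun r => (d : ℝ) / (2 * n) ≤ |signVec (r q.1) ⬝ᵥ signVec (r q.2)|
    else ∅
  have hB₁ : ∀ q, ((B₁ q).card : ℝ) ≤
      2 * Fintype.card (Fin n → Fin d → Bool) * Real.exp (-(δ ^ 2 * d / 2)) := by
    intro q
    by_cases hq : q.1 ≤ q.2.2
    · simp only [B₁, if_pos hq]
      convert card_le_abs_signVec_dotProduct q.2.2 (Y q.1 q.2.1) (fun r v => ?_)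
        (ρ := R ^ 2) (s := δ / (2 * c)) (by positivity) (by positivity)
        (fun r => (ellNorm_two_le_iff hR.le _).1
          (alg (truncatedHistory alg O (scaledSigns c r) δ q.1) q.2.1).2) using 3
      · have h : c ^ 2 * R ^ 2 * d = 1 / 4 := by
          rw [← Real.sq_sqrt hd0.le, ← mul_pow, ← mul_pow, hcR]
          norm_num
        field_simp
        linear_combination -4 * h
      · simp only [Y]
        rw [truncatedHistory_congr alg O δ fun i hi =>
          scaledSigns_update c r q.2.2 v (lt_of_lt_of_le hi hq)]
    · simp only [B₁, if_neg hq]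
      simp only [Finset.card_empty, Nat.cast_zero]
      positivity
  have hB₂ : ∀ q, ((B₂ q).card : ℝ) ≤
      2 * Fintype.card (Fin n → Fin d → Bool) * Real.exp (-(d / (8 * n ^ 2))) := by
    intro q
    by_cases hq : q.1 ≠ q.2
    · simp only [B₂, if_pos hq]
      convert card_le_abs_signVec_dotProduct q.1 (fun r => signVec (r q.2)) (fun r v => ?_)
        (ρ := d) (s := d / (2 * n)) (by positivity) (by positivity) (fun r => ?_) using 3
      · field_simp
        norm_num
      · rw [Function.update_of_ne hq.symm]
      · simp [sq, signVec_mul_self]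
    · simp only [B₂, if_neg hq]
      simp only [Finset.card_empty, Nat.cast_zero]
      positivity
  have hsub : (Finset.univ.filter fun r : Fin n → Fin d → Bool => ∃ t < τ, ∃ k,
      IsEpsSolution (maxAffine (scaledSigns c r) δ (n - 1)) (l2Ball d R) ε
        (alg.batch O (maxAffine (scaledSigns c r) δ (n - 1)) t k)) ⊆
      Finset.univ.biUnion B₁ ∪ Finset.univ.biUnion B₂ := by
    intro r hr
    obtain ⟨t, ht, k, hk⟩ := (Finset.mem_filter.1 hr).2
    by_contra hbad
    simp only [Finset.mem_union, Finset.mem_biUnion, Finset.mem_univ, true_and, not_or,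
      not_exists] at hbad
    obtain ⟨hb₁, hb₂⟩ := hbad
    obtain ⟨y, hy, hyv⟩ := exists_descent_point hn hd hR.le r fun i j hij => by
      have := hb₂ (i, j)
      simp only [B₂, if_pos hij, Finset.mem_filter, Finset.mem_univ, true_and, not_le] at this
      exact this
    refine not_isEpsSolution_batch (N := n - 1) (δ := δ) (w := scaledSigns c r) hO (hF r) alg
      (fun t ht i hi hti k => ?_) hy (maxAffine_le_iff.2 fun i hi => ?_) (by omega) k hk
    · have hi' : i < n := by omega
      have := hb₁ (⟨t, by omega⟩, k, ⟨i, hi'⟩)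
      rw [show B₁ (⟨t, by omega⟩, k, ⟨i, hi'⟩) = Finset.univ.filter fun r =>
        δ / (2 * c) ≤ |signVec (r ⟨i, hi'⟩) ⬝ᵥ Y t k r| from if_pos hti] at this
      simp only [Finset.mem_filter, Finset.mem_univ, true_and, not_le] at this
      rw [scaledSigns, dif_pos hi', smul_dotProduct, smul_eq_mul, abs_mul, abs_of_pos hc]
      rw [lt_div_iff₀ (by positivity)] at this
      simp only [Y] at this
      linarith
    · have hi' : i < n := by omega
      rw [scaledSigns, dif_pos hi', smul_dotProduct, smul_eq_mul]
      have h1 := mul_le_mul_of_nonneg_left (hyv ⟨i, hi'⟩) hc.le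
      have h2 : c * -(R * √d / (2 * √(2 * n))) = -(1 / (4 * √(2 * n))) := by
        rw [mul_neg, ← mul_div_assoc, ← mul_assoc, hcR]
        field_simp
        norm_num
      have h3 : ((n - 1 : ℕ) : ℝ) = n - 1 := by
        rw [Nat.cast_sub hn, Nat.cast_one]
      have h4 : 0 ≤ (i : ℝ) * δ := by positivity
      rw [h3]
      linarith
  have hcard := ((Finset.card_le_card hsub).trans (Finset.card_union_le _ _)).trans
    (add_le_add Finset.card_biUnion_le Finset.card_biUnion_le)
  have hcard' : ((Finset.univ.filter fun r : Fin n → Fin d → Bool => ∃ t < τ, ∃ k,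
      IsEpsSolution (maxAffine (scaledSigns c r) δ (n - 1)) (l2Ball d R) ε
        (alg.batch O (maxAffine (scaledSigns c r) δ (n - 1)) t k)).card : ℝ) ≤
      ∑ q, ((B₁ q).card : ℝ) + ∑ q, ((B₂ q).card : ℝ) := by exact_mod_cast hcard
  refine hcard'.trans ((add_le_add (Finset.sum_le_sum fun q _ => hB₁ q)
    (Finset.sum_le_sum fun q _ => hB₂ q)).trans_eq ?_)
  simp only [Finset.sum_const, Finset.card_univ, Fintype.card_prod, Fintype.card_fin,
    nsmul_eq_mul]
  push_cast
  ring

/-! ### Choice of the parameters -/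

lemma union_bound_lt {n K d : ℕ} {M ε γ : ℝ} (hn : 1 ≤ n) (hK : 1 ≤ K)
    (hε : ε ∈ Set.Ioo (0 : ℝ) (1 / 2)) (hγ : γ ∈ Set.Ioo (0 : ℝ) 1) (hnM : (n : ℝ) ≤ M)
    (hMK : 2 * γ ≤ M * K) (hM : M ≤ ε * √(d : ℝ) / (32 * √(Real.log (M * K / γ)))) :
    2 * n ^ 2 * (K * Real.exp (-((ε / n) ^ 2 * d / 2)) + Real.exp (-(d / (8 * n ^ 2)))) < γ := by
  obtain ⟨hε0, hε1⟩ := hε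
  obtain ⟨hγ0, hγ1⟩ := hγ
  have hn0 : (0 : ℝ) < n := by exact_mod_cast hn
  have hK1 : (1 : ℝ) ≤ K := by exact_mod_cast hK
  have hK0 : (0 : ℝ) < K := by linarith
  have hM0 : 0 < M := by linarith
  have hx0 : 0 < M * K / γ := by positivity
  have hx2 : 2 ≤ M * K / γ := by rwa [le_div_iff₀ hγ0]
  set L := Real.log (M * K / γ) with hL
  have hL0 : 0 < L := Real.log_pos (by linarith)
  have hdim : 1024 * n ^ 2 * L ≤ ε ^ 2 * d := by
    rw [le_div_iff₀ (by positivity)] at hM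
    have h := pow_le_pow_left₀ (by positivity) hM 2
    rw [mul_pow, mul_pow, mul_pow, Real.sq_sqrt hL0.le, Real.sq_sqrt (by positivity)] at h
    have : (n : ℝ) ^ 2 * L ≤ M ^ 2 * L := by gcongr
    linarith
  have hε2 : ε ^ 2 * d ≤ d := by
    have : ε ^ 2 ≤ 1 := by nlinarith
    have := mul_le_mul_of_nonneg_right this (Nat.cast_nonneg (α := ℝ) d)
    linarith
  have hnL : 0 < (n : ℝ) ^ 2 * L := by positivity
  have he1 : Real.exp (-((ε / n) ^ 2 * d / 2)) ≤ Real.exp (-(6 * L)) := by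
    gcongr
    rw [div_pow, div_mul_eq_mul_div, div_div, le_div_iff₀ (by positivity)]
    linarith
  have he2 : Real.exp (-(d / (8 * n ^ 2))) ≤ Real.exp (-(6 * L)) := by
    gcongr
    rw [le_div_iff₀ (by positivity)]
    linarith
  set u := γ / (M * K) with hu
  have hu0 : 0 < u := by positivity
  have hu2 : u ≤ 1 / 2 := by
    rw [hu, div_le_div_iff₀ (by positivity) two_pos]
    linarith
  have heu : Real.exp (-(6 * L)) = u ^ 6 := by
    rw [hu, ← inv_div (M * K) γ, ← Real.exp_log hx0, ← hL, ← Real.exp_neg, ← Real.exp_nat_mul]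
    congr 1
    push_cast
    ring
  rw [heu] at he1 he2
  have hMu : n * u ≤ γ / K := by
    calc n * u ≤ M * u := by gcongr
      _ = γ / K := by
          rw [hu]
          field_simp
  have hγK : γ / K * K = γ := by field_simp
  calc _ ≤ 2 * (n : ℝ) ^ 2 * (K * u ^ 6 + K * u ^ 6) := by
        gcongr
        exact he2.trans (le_mul_of_one_le_left (by positivity) hK1)
    _ = 4 * (n * u) ^ 2 * K * u ^ 4 := by ring
    _ ≤ 4 * (γ / K) ^ 2 * K * (1 / 2) ^ 4 := by gcongr
    _ = γ * ((γ / K) / 4) := by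
        rw [sq]
        linear_combination (1 / 4 * (γ / K)) * hγK
    _ < γ * 1 := by
        gcongr
        have : γ / K ≤ γ := div_le_self hγ0.le hK1
        linarith
    _ = γ := mul_one γ

section Bounds

variable {A : Type*} {d K : ℕ} {p ε γ M : ℝ} {F : Set ((Fin d → ℝ) → ℝ)}
  {O : ((Fin d → ℝ) → ℝ) → (Fin d → ℝ) → A}

lemma maxAffine_mem_class (hd : 1 ≤ d) (hp : 1 ≤ p)
    (hF : F = boundedSubgradientVariation d p 1 ∨ F = lipschitzConvex d p 1)
    {w : ℕ → Fin d → ℝ} (hw : ∀ i l, |w i l| ≤ 1 / 2 * (d : ℝ) ^ (1 / p - 1)) (δ : ℝ) (j : ℕ) :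
    maxAffine w δ j ∈ F :=
  mem_class_of_convexOn_of_lipschitz hF convexOn_maxAffine
    (abs_maxAffine_sub_le fun i => abs_dotProduct_le_mul_ellNorm hd hp (by norm_num) (hw i))

/-- The scale of the subgradients, the radius of the ball and the dimension balance. -/
lemma scale_mul_radius_mul_sqrt (hd : 1 ≤ d) (p : ℝ) :
    1 / 2 * (d : ℝ) ^ (1 / p - 1) * (d : ℝ) ^ (-(1 / p - 1 / 2)) * √d = 1 / 2 := by
  have hd0 : (0 : ℝ) < d := by exact_mod_cast hd
  rw [Real.sqrt_eq_rpow, mul_assoc, mul_assoc, ← Real.rpow_add hd0, ← Real.rpow_add hd0]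
  ring_nf
  simp

lemma le_hpComplexity_of_le_one (hd : 1 ≤ d) (hp : 1 ≤ p)
    (hF : F = boundedSubgradientVariation d p 1 ∨ F = lipschitzConvex d p 1) (hγ : 0 < γ)
    (hM : M ≤ 1) (X : Set (Fin d → ℝ)) : ENNReal.ofReal M ≤ hpComplexity F X O K ε γ := by
  refine le_hpComplexity_of_card_lt (fun f hf => continuous_of_mem_class hF hf)
    (fun _ : Unit => maxAffine (fun _ => 0) 0 0)
    (fun _ => maxAffine_mem_class hd hp hF (fun i l => ?_) 0 0) fun alg τ hτ => ?_
  · simp only [Pi.zero_apply, abs_zero]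
    positivity
  · have : τ = 0 := by
      have : (τ : ℝ) < 1 := hτ.trans_le hM
      exact Nat.lt_one_iff.1 (by exact_mod_cast this)
    subst this
    simpa using hγ

/-- A single query cannot solve both of two opposite linear objectives. This covers the values
of `γ` so close to `1` that the dimension may be bounded and no concentration is available. -/
lemma le_hpComplexity_of_half_lt (hd : 1 ≤ d) (hp : 1 ≤ p)
    (hF : F = boundedSubgradientVariation d p 1 ∨ F = lipschitzConvex d p 1)
    (hε : ε < 1 / 2) (hγ : 1 / 2 < γ) (hM : M ≤ 2) (hK : K = 1) :
    ENNReal.ofReal M ≤ hpComplexity F (l2Ball d ((d : ℝ) ^ (-(1 / p - 1 / 2)))) O K ε γ := by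
  subst hK
  have hd0 : (0 : ℝ) < d := by exact_mod_cast hd
  set c := 1 / 2 * (d : ℝ) ^ (1 / p - 1) with hc
  set R := (d : ℝ) ^ (-(1 / p - 1 / 2)) with hR
  have hcR : c * R * √d = 1 / 2 := scale_mul_radius_mul_sqrt hd p
  have hR0 : 0 ≤ R := by positivity
  have hc0 : 0 ≤ c := by positivity
  let s : Bool → Fin d → ℝ := fun b => signVec fun _ => b
  have hval : ∀ b x, maxAffine (fun _ => c • s b) 0 0 x = c * (s b ⬝ᵥ x) := fun b x => by
    simp [maxAffine]
  refine le_hpComplexity_of_card_lt (fun f hf => continuous_of_mem_class hF hf)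
    (fun b : Bool => maxAffine (fun _ => c • s b) 0 0)
    (fun b => maxAffine_mem_class hd hp hF (fun i l => ?_) 0 0) fun alg τ hτ => ?_
  · rw [Pi.smul_apply, smul_eq_mul, abs_mul, abs_signVec, mul_one, abs_of_nonneg hc0]
  have hτ1 : τ < 2 := by exact_mod_cast hτ.trans_le hM
  -- the common first query is a solution for a given sign only if the objective is negative there
  have hneg : ∀ b, (∃ t < τ, ∃ k, IsEpsSolution (maxAffine (fun _ => c • s b) 0 0) (l2Ball d R) ε
      (alg.batch O (maxAffine (fun _ => c • s b) 0 0) t k)) →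
      c * (s b ⬝ᵥ (alg [] 0 : Fin d → ℝ)) < 0 := by
    rintro b ⟨t, ht, k, -, h⟩
    obtain rfl : t = 0 := by omega
    obtain rfl : k = 0 := Subsingleton.elim _ _
    have h1 := h (-(R / √d) • s b) <| (ellNorm_two_le_iff hR0 _).2 <| by
      simp only [Pi.smul_apply, smul_eq_mul, mul_pow, neg_sq, div_pow, Real.sq_sqrt hd0.le, s]
      simp only [sq (signVec _ _), signVec_mul_self, Finset.sum_const, Finset.card_univ,
        Fintype.card_fin, nsmul_eq_mul]
      apply le_of_eq
      field_simp
    have h2 : c * (s b ⬝ᵥ -(R / √d) • s b) = -(1 / 2) := by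
      rw [dotProduct_smul, signVec_dotProduct_self, ← hcR, smul_eq_mul]
      nth_rewrite 2 [← Real.mul_self_sqrt hd0.le]
      field_simp
    rw [hval, hval, h2] at h1
    have h3 : alg.batch O (maxAffine (fun _ => c • s b) 0 0) 0 0 = alg [] 0 := rfl
    rw [h3] at h1
    linarith
  have hopp : s true = -s false := by
    ext l
    simp [s, signVec]
  have hne : ∃ b, ¬ ∃ t < τ, ∃ k, IsEpsSolution (maxAffine (fun _ => c • s b) 0 0) (l2Ball d R) ε
      (alg.batch O (maxAffine (fun _ => c • s b) 0 0) t k) := by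
    by_contra! hall
    have h1 := hneg true (hall true)
    have h2 := hneg false (hall false)
    rw [hopp, neg_dotProduct, mul_neg] at h1
    linarith
  obtain ⟨b, hb⟩ := hne
  classical
  have hlt := Finset.card_lt_univ_of_notMem (s := Finset.univ.filter fun b => ∃ t < τ, ∃ k,
    IsEpsSolution (maxAffine (fun _ => c • s b) 0 0) (l2Ball d R) ε
      (alg.batch O (maxAffine (fun _ => c • s b) 0 0) t k)) (x := b) (by simpa using hb)
  rw [Fintype.card_bool] at hlt ⊢
  have hle : ((Finset.univ.filter fun b => ∃ t < τ, ∃ k,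
    IsEpsSolution (maxAffine (fun _ => c • s b) 0 0) (l2Ball d R) ε
      (alg.batch O (maxAffine (fun _ => c • s b) 0 0) t k)).card : ℝ) ≤ 1 := by
    exact_mod_cast Nat.lt_succ_iff.1 hlt
  push_cast
  refine lt_of_le_of_lt ?_ (show (1 : ℝ) < γ * 2 by linarith)
  convert hle

lemma le_hpComplexity_of_two_mul_le (hd : 1 ≤ d) (hK : 1 ≤ K) (hp : 1 ≤ p)
    (hF : F = boundedSubgradientVariation d p 1 ∨ F = lipschitzConvex d p 1)
    (hO : IsLocalOracle F (l2Ball d ((d : ℝ) ^ (-(1 / p - 1 / 2)))) O)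
    (hε : ε ∈ Set.Ioo (0 : ℝ) (1 / 2)) (hγ : γ ∈ Set.Ioo (0 : ℝ) 1) (hM1 : 1 < M)
    (hMK : 2 * γ ≤ M * K) (hMε : M ≤ 1 / (200 * ε ^ 2))
    (hM : M ≤ ε * √(d : ℝ) / (32 * √(Real.log (M * K / γ)))) :
    ENNReal.ofReal M ≤ hpComplexity F (l2Ball d ((d : ℝ) ^ (-(1 / p - 1 / 2)))) O K ε γ := by
  have hε0 := hε.1
  have hd0 : (0 : ℝ) < d := by exact_mod_cast hd
  -- the largest number of rounds below `M`
  obtain ⟨n, hn⟩ : ∃ n, ⌈M⌉₊ = n + 1 :=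
    Nat.exists_eq_succ_of_ne_zero (Nat.ceil_pos.2 (by linarith)).ne'
  have hnM : (n : ℝ) < M := Nat.lt_ceil.1 (by omega)
  have hn1 : 1 ≤ n := by
    have : 1 < ⌈M⌉₊ := Nat.lt_ceil.2 (by exact_mod_cast hM1)
    omega
  have hn0 : (0 : ℝ) < n := by exact_mod_cast hn1
  have hc0 : 0 < 1 / 2 * (d : ℝ) ^ (1 / p - 1) := by positivity
  have hmem : ∀ (r : Fin n → Fin d → Bool) j,
      maxAffine (scaledSigns (1 / 2 * (d : ℝ) ^ (1 / p - 1)) r) (ε / n) j ∈ F := fun r j =>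
    maxAffine_mem_class hd hp hF (abs_scaledSigns_le hc0.le r) _ j
  refine le_hpComplexity_of_card_lt (fun f hf => continuous_of_mem_class hF hf)
    (fun r : Fin n → Fin d → Bool =>
      maxAffine (scaledSigns (1 / 2 * (d : ℝ) ^ (1 / p - 1)) r) (ε / n) (n - 1))
    (fun r => hmem r _) fun alg τ hτ => ?_
  have hτn : τ ≤ n := by
    have := Nat.lt_ceil.2 hτ
    omega
  refine (card_solved_le hn1 hd hc0 (by positivity) (scale_mul_radius_mul_sqrt hd p)
    (by positivity) ?_ hO hmem alg hτn).trans_lt ?_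
  · have h1 : 8 * ε * √(2 * n) ≤ 1 := by
      refine abs_le_of_sq_le_sq' ?_ zero_le_one |>.2
      rw [mul_pow, mul_pow, Real.sq_sqrt (by positivity)]
      rw [le_div_iff₀ (by positivity)] at hMε
      have : n * (200 * ε ^ 2) ≤ M * (200 * ε ^ 2) := by gcongr
      linarith
    rw [mul_div_cancel₀ _ hn0.ne', le_div_iff₀ (by positivity)]
    linarith
  · have : (0 : ℝ) < Fintype.card (Fin n → Fin d → Bool) := by exact_mod_cast Fintype.card_pos
    gcongr
    exact union_bound_lt hn1 hK hε hγ hnM.le hMK hM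

end Bounds

theorem theorem4 {A : Type*} (d K : ℕ) (hd : 1 ≤ d) (hK : 1 ≤ K) (p ε γ : ℝ)
    (hp : p ∈ Set.Icc (1 : ℝ) 2) (hε : ε ∈ Set.Ioo (0 : ℝ) (1 / 2))
    (hγ : γ ∈ Set.Ioo (0 : ℝ) 1)
    (F : Set ((Fin d → ℝ) → ℝ))
    (hF : F = boundedSubgradientVariation d p 1 ∨ F = lipschitzConvex d p 1)
    (O : ((Fin d → ℝ) → ℝ) → (Fin d → ℝ) → A)
    (hO : IsLocalOracle F (l2Ball d ((d : ℝ) ^ (-(1 / p - 1 / 2)))) O) :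
    (∀ M : ℝ, γ < M * K →
      M ≤ min (1 / (200 * ε ^ 2)) (ε * √(d : ℝ) / (32 * √(Real.log (M * K / γ)))) →
      ENNReal.ofReal M ≤
        hpComplexity F (l2Ball d ((d : ℝ) ^ (-(1 / p - 1 / 2)))) O K ε γ) ∧
    (16 / 625 * Real.log (K / (200 * ε ^ 2 * γ)) / ε ^ 6 ≤ d →
      ENNReal.ofReal (1 / (200 * ε ^ 2)) ≤
        hpComplexity F (l2Ball d ((d : ℝ) ^ (-(1 / p - 1 / 2)))) O K ε γ) := by
  have hε0 := hε.1
  have hγ0 := hγ.1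
  have hK1 : (1 : ℝ) ≤ K := by exact_mod_cast hK
  have key : ∀ M : ℝ, γ < M * K →
      M ≤ min (1 / (200 * ε ^ 2)) (ε * √(d : ℝ) / (32 * √(Real.log (M * K / γ)))) →
      ENNReal.ofReal M ≤
        hpComplexity F (l2Ball d ((d : ℝ) ^ (-(1 / p - 1 / 2)))) O K ε γ := by
    intro M _ hM
    rcases le_or_gt M 1 with hM1 | hM1
    · exact le_hpComplexity_of_le_one hd hp.1 hF hγ0 hM1 _
    rcases le_or_gt (2 * γ) (M * K) with hMK | hMK
    · exact le_hpComplexity_of_two_mul_le hd hK hp.1 hF hO hε hγ hM1 hMK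
        (hM.trans (min_le_left _ _)) (hM.trans (min_le_right _ _))
    · have hγ1 := hγ.2
      have hK2 : (K : ℝ) < 2 := by nlinarith
      have hK2' : K < 2 := by exact_mod_cast hK2
      exact le_hpComplexity_of_half_lt hd hp.1 hF hε.2 (by nlinarith) (by nlinarith) (by omega)
  refine ⟨key, fun hd6 => ?_⟩
  rcases le_or_gt (1 / (200 * ε ^ 2) * K) γ with hle | hlt
  · refine le_hpComplexity_of_le_one hd hp.1 hF hγ0 ?_ _
    have : 1 / (200 * ε ^ 2) ≤ 1 / (200 * ε ^ 2) * K := le_mul_of_one_le_right (by positivity) hK1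
    linarith [hγ.2]
  refine key _ hlt (le_min le_rfl ?_)
  have harg : 1 / (200 * ε ^ 2) * K / γ = K / (200 * ε ^ 2 * γ) := by field_simp
  rw [harg]
  set L := Real.log (K / (200 * ε ^ 2 * γ)) with hL
  have hL0 : 0 < L := Real.log_pos (by rwa [← harg, lt_div_iff₀ hγ0, one_mul])
  rw [div_le_div_iff₀ (by positivity) (by positivity), one_mul]
  rw [div_le_iff₀ (by positivity)] at hd6
  have h1 : 4 / 25 * √L ≤ √d * ε ^ 3 := by
    refine abs_le_of_sq_le_sq' ?_ (by positivity) |>.2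
    rw [mul_pow, mul_pow, Real.sq_sqrt hL0.le, Real.sq_sqrt (by positivity)]
    nlinarith
  nlinarith
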